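/- Let $K$ be a field and let $0<n_1<n_2<n_3<n_4$ be integers with $\gcd(n_1,n_2,n_3,n_4)=1$. Let $C$ be the monomial curve $x_i=t^{n_i}$ ($1\le i\le 4$) in $\mathbb{A}^4(K)$, and let $I(C)\subset K[x_1,x_2,x_3,x_4]$ be its toric ideal, i.e. the kernel of the $K$-algebra homomorphism $K[x_1,\dots,x_4]\to K[t]$, $x_i\mapsto t^{n_i}$. Suppose that $I(C)$ is given as in Gorenstein case 3(b), i.e. that $I(C)$ is minimally generated by the five binomials $$x_1^{a_1}-x_2^{a_{12}}x_4^{a_{14}},\quad x_2^{a_2}-x_3^{a_{23}}x_4^{a_{24}},\quad x_3^{a_3}-x_1^{a_{31}}x_2^{a_{32}},\quad x_4^{a_4}-x_1^{a_{41}}x_3^{a_{43}},\quad x_2^{a_{12}}x_3^{a_{43}}-x_1^{a_{31}}x_4^{a_{24}},$$ where the exponents are integers with $0<a_{ij}<a_j$ for all occurring pairs $(i,j)$. Suppose moreover that $a_{43}\le a_{23}$. Then $C$ has Cohen–Macaulay tangent cone at the origin, i.e. the ring $K[x_1,\dots,x_4]/I(C)_*$ is Cohen–Macaulay, where $I(C)_*$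 is the ideal generated by the homogeneous summands $f_*$ of least degree of all $f\in I(C)$, if and only if both of the following hold: 1. $a_{12}+a_{43}\le a_{31}+a_{24}$; 2. either $a_{24}<a_{14}$ and $a_2+a_{12}\le a_{31}+2a_{24}+a_{23}-a_{43}$, or $a_{14}\le a_{24}$ and $a_2+a_{12}\le a_1+a_{23}+a_{24}-a_{14}$. -/

import Mathlib

namespace MonomialCurve

/-- The toric ideal `I(C)` of the monomial curve `x_i = t ^ (n i)`: the kernel of the
`K`-algebra homomorphism `K[x_1, …, x_d] → K[t]` sending `x_i` to `t ^ (n i)`. -/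
noncomputable def toricIdeal (K : Type*) [Field K] {d : ℕ} (n : Fin d → ℕ) :
    Ideal (MvPolynomial (Fin d) K) :=
  RingHom.ker
    (MvPolynomial.aeval (fun i => (Polynomial.X : Polynomial K) ^ n i) :
      MvPolynomial (Fin d) K →ₐ[K] Polynomial K)

/-- The homogeneous summand `f_*` of least (standard) degree of a polynomial `f`
(with `0_* = 0`). -/
noncomputable def initialForm {K : Type*} [Field K] {d : ℕ} (f : MvPolynomial (Fin d) K) :
    MvPolynomial (Fin d) K :=
  MvPolynomial.homogeneousComponent
    (sInf {k : ℕ | MvPolynomial.homogeneousComponent k f ≠ 0}) f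

/-- The ideal `I_*` generated by the polynomials `f_*` for `f ∈ I`. -/
noncomputable def initialIdeal {K : Type*} [Field K] {d : ℕ}
    (I : Ideal (MvPolynomial (Fin d) K)) : Ideal (MvPolynomial (Fin d) K) :=
  Ideal.span {g | ∃ f ∈ I, g = initialForm f}

/-- The coordinate ring `K[x_1, …, x_d] / I(C)_*` of the tangent cone at the origin of the
monomial curve with exponents `n`. -/
abbrev TangentConeRing (K : Type*) [Field K] {d : ℕ} (n : Fin d → ℕ) : Type _ :=
  MvPolynomial (Fin d) K ⧸ initialIdeal (toricIdeal K n)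

/-- A Noetherian local ring is Cohen–Macaulay if it has a regular sequence whose length is the
Krull dimension. (For a local ring, `RingTheory.Sequence.IsRegular` forces all the members of
the sequence to lie in the maximal ideal.) -/
def IsCohenMacaulayLocalRing (R : Type*) [CommRing R] [IsLocalRing R] : Prop :=
  IsNoetherianRing R ∧
    ∃ rs : List R, RingTheory.Sequence.IsRegular R rs ∧
      ((rs.length : ℕ) : WithBot ℕ∞) = ringKrullDim R

/-- A Noetherian ring is Cohen–Macaulay if all its localizations at maximal ideals are. -/
def IsCohenMacaulayRing (R : Type*) [CommRing R] : Prop :=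
  IsNoetherianRing R ∧
    ∀ (m : Ideal R) [m.IsMaximal], IsCohenMacaulayLocalRing (Localization.AtPrime m)

/-- The monomial curve with exponents `n` has Cohen–Macaulay tangent cone at the origin. -/
def HasCohenMacaulayTangentCone (K : Type*) [Field K] {d : ℕ} (n : Fin d → ℕ) : Prop :=
  IsCohenMacaulayRing (TangentConeRing K n)

/-- The five binomials
`x₁^a1 - x₂^a12 x₄^a14`, `x₂^a2 - x₃^a23 x₄^a24`, `x₃^a3 - x₁^a31 x₂^a32`,
`x₄^a4 - x₁^a41 x₃^a43`, `x₂^a12 x₃^a43 - x₁^a31 x₄^a24`.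
The variables `x₁, x₂, x₃, x₄` are `X 0, X 1, X 2, X 3`. -/
noncomputable def case3bGenerators (K : Type*) [Field K]
    (a1 a2 a3 a4 a12 a14 a23 a24 a31 a32 a41 a43 : ℕ) : Set (MvPolynomial (Fin 4) K) :=
  { MvPolynomial.X 0 ^ a1 - MvPolynomial.X 1 ^ a12 * MvPolynomial.X 3 ^ a14,
    MvPolynomial.X 1 ^ a2 - MvPolynomial.X 2 ^ a23 * MvPolynomial.X 3 ^ a24,
    MvPolynomial.X 2 ^ a3 - MvPolynomial.X 0 ^ a31 * MvPolynomial.X 1 ^ a32,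
    MvPolynomial.X 3 ^ a4 - MvPolynomial.X 0 ^ a41 * MvPolynomial.X 2 ^ a43,
    MvPolynomial.X 1 ^ a12 * MvPolynomial.X 2 ^ a43
      - MvPolynomial.X 0 ^ a31 * MvPolynomial.X 3 ^ a24 }

/-- The ideal `I(C)` is given as in case 3(b): `n 0 < n 1 < n 2 < n 3` are positive integers with
greatest common divisor `1`, the exponents satisfy `0 < a_ij < a_j`, and the toric ideal is
minimally generated by the five binomials above (no proper subset of them generates it). -/
structure IsCase3b (K : Type*) [Field K] (n : Fin 4 → ℕ)
    (a1 a2 a3 a4 a12 a14 a23 a24 a31 a32 a41 a43 : ℕ) : Prop where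
  pos : 0 < n 0
  strictMono : StrictMono n
  gcd_eq_one : Finset.univ.gcd n = 1
  bound12 : 0 < a12 ∧ a12 < a2
  bound14 : 0 < a14 ∧ a14 < a4
  bound23 : 0 < a23 ∧ a23 < a3
  bound24 : 0 < a24 ∧ a24 < a4
  bound31 : 0 < a31 ∧ a31 < a1
  bound32 : 0 < a32 ∧ a32 < a2
  bound41 : 0 < a41 ∧ a41 < a1
  bound43 : 0 < a43 ∧ a43 < a3
  span_eq : Ideal.span (case3bGenerators K a1 a2 a3 a4 a12 a14 a23 a24 a31 a32 a41 a43)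
    = toricIdeal K n
  minimal : ∀ T, T ⊂ case3bGenerators K a1 a2 a3 a4 a12 a14 a23 a24 a31 a32 a41 a43 →
    Ideal.span T ≠ toricIdeal K n

end MonomialCurve

/-! Give `x ^ u` the weight `Σ uᵢ nᵢ`; a fibre is the set of monomials of one weight, and its
longest members are those of largest degree. The ideal `I(C)_*` contains every monomial that is not
longest and every difference of two longest monomials of one fibre, and nothing beyond their span:
it is the kernel of the linear map sending a longest monomial to `t ^ weight` and the others to zero
(`mem_initialIdeal_iff`).

Since `n 0` is the least weight, all variables but the first are nilpotent in the tangent cone,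
whose dimension is at most one. Cohen–Macaulayness therefore amounts to `x₁` being a nonzerodivisor,
which means that multiplication by `x₁` carries longest monomials to longest monomials
(`hasCohenMacaulayTangentCone_iff`).

The rest is combinatorics. Two monomials of one fibre are joined by moves exchanging the two terms
of a generator (`iff_of_weight_eq`). The first four generators have a longer side forced by the
order of the `n i`; for the fifth this is condition 1. Condition 2 concerns `x₂ ^ (a₂ + a₁₂)`, which
reaches a multiple of `x₁` only by first passing through the shorter `x₂ ^ a₁₂ x₃ ^ a₂₃ x₄ ^ a₂₄`.
Comparing these monomials gives necessity (`conditions_of_isLongest_add`); sufficiency holds because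
no other obstruction occurs (`exists_first_pos_of_conditions`). -/

namespace MonomialCurve

/-! ### Longest monomials and the initial ideal of a toric ideal. -/

open MvPolynomial

variable {K : Type*} [Field K] {d : ℕ} {n : Fin d → ℕ}

/-- An exponent vector is longest if no monomial of the same weight has larger degree. -/
def IsLongest (n : Fin d → ℕ) (u : Fin d →₀ ℕ) : Prop :=
  ∀ v : Fin d →₀ ℕ, Finsupp.weight n v = Finsupp.weight n u → v.degree ≤ u.degree

theorem IsLongest.of_weight_eq {u v : Fin d →₀ ℕ} (hu : IsLongest n u)
    (hw : Finsupp.weight n v = Finsupp.weight n u) (hd : u.degree ≤ v.degree) :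
    IsLongest n v :=
  fun w h => (hu w (h.trans hw)).trans hd

theorem IsLongest.degree_eq {u v : Fin d →₀ ℕ} (hu : IsLongest n u) (hv : IsLongest n v)
    (hw : Finsupp.weight n v = Finsupp.weight n u) : u.degree = v.degree :=
  le_antisymm (hv u hw.symm) (hu v hw)

theorem IsLongest.of_add {u w : Fin d →₀ ℕ} (h : IsLongest n (u + w)) : IsLongest n u := by
  intro v hv
  have := h (v + w) (by simp [hv])
  simpa using this

theorem IsLongest.add_of_weight_eq {u v w : Fin d →₀ ℕ} (hv : IsLongest n v)
    (hw : Finsupp.weight n u = Finsupp.weight n v) (h : IsLongest n (u + w)) :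
    IsLongest n (v + w) :=
  h.of_weight_eq (by simp [hw]) (by simpa using hv u hw)

theorem exists_degree_lt_of_not_isLongest {u : Fin d →₀ ℕ} (h : ¬ IsLongest n u) :
    ∃ v : Fin d →₀ ℕ, Finsupp.weight n v = Finsupp.weight n u ∧ u.degree < v.degree := by
  simpa [IsLongest] using h

theorem aeval_pow_monomial (u : Fin d →₀ ℕ) (c : K) :
    aeval (fun i => (Polynomial.X : Polynomial K) ^ n i) (monomial u c)
      = Polynomial.monomial (Finsupp.weight n u) c := by
  rw [aeval_monomial, ← Polynomial.C_mul_X_pow_eq_monomial, Finsupp.weight_apply,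
    Finsupp.prod, Finsupp.sum, ← Finset.prod_pow_eq_pow_sum]
  simp only [← pow_mul, smul_eq_mul, mul_comm]
  rfl

theorem monomial_sub_monomial_mem_toricIdeal_iff {u v : Fin d →₀ ℕ} :
    (monomial u 1 - monomial v 1 : MvPolynomial (Fin d) K) ∈ toricIdeal K n ↔
      Finsupp.weight n u = Finsupp.weight n v := by
  rw [toricIdeal, RingHom.mem_ker]
  erw [map_sub]
  rw [aeval_pow_monomial, aeval_pow_monomial, sub_eq_zero]
  constructor
  · intro h
    have := congrArg Polynomial.natDegree h
    rwa [Polynomial.natDegree_monomial_eq _ one_ne_zero,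
      Polynomial.natDegree_monomial_eq _ one_ne_zero] at this
  · intro h; rw [h]

theorem initialForm_eq {f : MvPolynomial (Fin d) K} {k : ℕ} (hk : homogeneousComponent k f ≠ 0)
    (hlt : ∀ j < k, homogeneousComponent j f = 0) :
    initialForm f = homogeneousComponent k f := by
  have : sInf {k : ℕ | homogeneousComponent k f ≠ 0} = k := by
    refine le_antisymm (Nat.sInf_le hk) (le_csInf ⟨k, hk⟩ fun j hj => ?_)
    by_contra! h
    exact hj (hlt j h)
  rw [initialForm, this]

theorem homogeneousComponent_monomial (k : ℕ) (u : Fin d →₀ ℕ) (c : K) :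
    homogeneousComponent k (monomial u c) = if u.degree = k then monomial u c else 0 := by
  split_ifs with h
  · exact homogeneousComponent_of_mem (isHomogeneous_monomial c h) |>.trans (by simp)
  · exact homogeneousComponent_of_mem (isHomogeneous_monomial c rfl) |>.trans
      (by simp [Ne.symm h])

theorem monomial_mem_initialIdeal {u : Fin d →₀ ℕ} (h : ¬ IsLongest n u) :
    (monomial u 1 : MvPolynomial (Fin d) K) ∈ initialIdeal (toricIdeal K n) := by
  obtain ⟨v, hv, hd⟩ := exists_degree_lt_of_not_isLongest h
  refine Ideal.subset_span ⟨monomial u 1 - monomial v 1,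
    monomial_sub_monomial_mem_toricIdeal_iff.2 hv.symm, ?_⟩
  have hk : homogeneousComponent u.degree (monomial u 1 - monomial v 1 : MvPolynomial (Fin d) K)
      = monomial u 1 := by
    rw [map_sub, homogeneousComponent_monomial, homogeneousComponent_monomial]
    simp [hd.ne']
  rw [initialForm_eq (k := u.degree), hk]
  · rw [hk]; simp
  · intro j hj
    rw [map_sub, homogeneousComponent_monomial, homogeneousComponent_monomial]
    simp [hj.ne', (hj.trans hd).ne']

theorem monomial_sub_monomial_mem_initialIdeal {u v : Fin d →₀ ℕ}
    (hw : Finsupp.weight n u = Finsupp.weight n v) (hd : u.degree = v.degree) :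
    (monomial u 1 - monomial v 1 : MvPolynomial (Fin d) K) ∈ initialIdeal (toricIdeal K n) := by
  by_cases huv : u = v
  · simp [huv]
  refine Ideal.subset_span ⟨monomial u 1 - monomial v 1,
    monomial_sub_monomial_mem_toricIdeal_iff.2 hw, ?_⟩
  have hk : homogeneousComponent u.degree (monomial u 1 - monomial v 1 : MvPolynomial (Fin d) K)
      = monomial u 1 - monomial v 1 := by
    rw [map_sub, homogeneousComponent_monomial, homogeneousComponent_monomial]
    simp [hd]
  rw [initialForm_eq (k := u.degree), hk]
  · rw [hk, sub_ne_zero]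
    intro h
    exact huv (monomial_left_injective one_ne_zero h)
  · intro j hj
    rw [map_sub, homogeneousComponent_monomial, homogeneousComponent_monomial]
    simp [hj.ne', (hd ▸ hj : j < v.degree).ne']

open Classical in
/-- The linear map sending a longest monomial `x ^ u` to `t ^ weight u` and every other monomial
to zero; its kernel is the initial ideal of the toric ideal. -/
noncomputable def longestMap (K : Type*) [Field K] (n : Fin d → ℕ) :
    MvPolynomial (Fin d) K →ₗ[K] Polynomial K :=
  (basisMonomials (Fin d) K).constr K
    fun u => if IsLongest n u then Polynomial.monomial (Finsupp.weight n u) 1 else 0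

open Classical in
theorem longestMap_monomial (u : Fin d →₀ ℕ) :
    longestMap K n (monomial u 1)
      = if IsLongest n u then Polynomial.monomial (Finsupp.weight n u) 1 else 0 := by
  have := Module.Basis.constr_basis (basisMonomials (Fin d) K) K
    (fun u => if IsLongest n u then Polynomial.monomial (Finsupp.weight n u) (1 : K) else 0) u
  rwa [coe_basisMonomials] at this

theorem longestMap_monomial_of_isLongest {u : Fin d →₀ ℕ} (h : IsLongest n u) :
    longestMap K n (monomial u 1) = Polynomial.monomial (Finsupp.weight n u) 1 := by
  rw [longestMap_monomial, if_pos h]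

theorem longestMap_monomial_of_not_isLongest {u : Fin d →₀ ℕ} (h : ¬ IsLongest n u) :
    longestMap K n (monomial u 1) = 0 := by
  rw [longestMap_monomial, if_neg h]

theorem linearMap_ext_monomial_one {M : Type*} [AddCommMonoid M] [Module K M]
    {f g : MvPolynomial (Fin d) K →ₗ[K] M}
    (h : ∀ u, f (monomial u 1) = g (monomial u 1)) : f = g :=
  (basisMonomials (Fin d) K).ext fun u => by simpa using h u

/-- Whether a longest `u` stays longest after adding `w` depends only on its weight, by
`IsLongest.add_of_weight_eq`. Multiplication by a monomial thus descends through `longestMap`, so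
the kernel is an ideal. -/
theorem longestMap_monomial_mul (w : Fin d →₀ ℕ) :
    ∃ M : Polynomial K →ₗ[K] Polynomial K, ∀ f : MvPolynomial (Fin d) K,
      longestMap K n (monomial w 1 * f) = M (longestMap K n f) := by
  classical
  let M : Polynomial K →ₗ[K] Polynomial K := (Polynomial.basisMonomials K).constr K
    fun s => if ∃ u, Finsupp.weight n u = s ∧ IsLongest n (u + w) then
      Polynomial.monomial (s + Finsupp.weight n w) 1 else 0
  have hM : ∀ s, M (Polynomial.monomial s 1) =
      if ∃ u, Finsupp.weight n u = s ∧ IsLongest n (u + w) then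
      Polynomial.monomial (s + Finsupp.weight n w) 1 else 0 := fun s => by
    have := Module.Basis.constr_basis (Polynomial.basisMonomials K) K
      (fun s => if ∃ u, Finsupp.weight n u = s ∧ IsLongest n (u + w) then
      Polynomial.monomial (s + Finsupp.weight n w) (1 : K) else 0) s
    rwa [Polynomial.coe_basisMonomials] at this
  refine ⟨M, fun f => ?_⟩
  have : longestMap K n ∘ₗ LinearMap.mulLeft K (monomial w 1) = M ∘ₗ longestMap K n := by
    refine linearMap_ext_monomial_one fun u => ?_
    simp only [LinearMap.comp_apply, LinearMap.mulLeft_apply, monomial_mul, one_mul]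
    rw [add_comm w u]
    by_cases hu : IsLongest n u
    · rw [longestMap_monomial_of_isLongest hu, hM]
      split_ifs with h
      · obtain ⟨v, hv, hvw⟩ := h
        rw [longestMap_monomial_of_isLongest (hu.add_of_weight_eq hv hvw), map_add]
      · exact longestMap_monomial_of_not_isLongest fun hh => h ⟨u, rfl, hh⟩
    · rw [longestMap_monomial_of_not_isLongest hu, map_zero,
        longestMap_monomial_of_not_isLongest fun hh => hu hh.of_add]
  exact LinearMap.congr_fun this f

theorem longestMap_mul_eq_zero (p : MvPolynomial (Fin d) K) {f : MvPolynomial (Fin d) K}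
    (hf : longestMap K n f = 0) : longestMap K n (p * f) = 0 := by
  induction p using MvPolynomial.induction_on' with
  | monomial u c =>
    obtain ⟨M, hM⟩ := longestMap_monomial_mul (K := K) (n := n) u
    have hc : monomial u c = c • (monomial u 1 : MvPolynomial (Fin d) K) := by simp [smul_monomial]
    rw [hc, smul_mul_assoc, map_smul, hM, hf, map_zero, smul_zero]
  | add p q hp hq => rw [add_mul, map_add, hp, hq, add_zero]

open Classical in
theorem coeff_longestMap (f : MvPolynomial (Fin d) K) (s : ℕ) :
    (longestMap K n f).coeff s = ∑ u ∈ f.support with IsLongest n u ∧ Finsupp.weight n u = s,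
      f.coeff u := by
  conv_lhs => rw [f.as_sum]
  rw [map_sum, Polynomial.finsetSum_coeff, Finset.sum_filter]
  refine Finset.sum_congr rfl fun u _ => ?_
  rw [← mul_one (coeff u f), ← smul_eq_mul, ← smul_monomial, map_smul, longestMap_monomial]
  by_cases h : IsLongest n u <;> simp [h, Polynomial.coeff_monomial]

open Classical in
theorem coeff_aeval_pow (f : MvPolynomial (Fin d) K) (s : ℕ) :
    (aeval (fun i => (Polynomial.X : Polynomial K) ^ n i) f).coeff s
      = ∑ u ∈ f.support with Finsupp.weight n u = s, f.coeff u := by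
  conv_lhs => rw [f.as_sum]
  rw [map_sum, Polynomial.finsetSum_coeff, Finset.sum_filter]
  refine Finset.sum_congr rfl fun u _ => ?_
  rw [aeval_pow_monomial, Polynomial.coeff_monomial]

/-- Let `k` be the least degree in `f` and fix a weight. If longest monomials of that weight have
degree `k`, every term of `f` of that weight has degree exactly `k`, and the coefficients sum to
zero because `f` vanishes on the curve. Otherwise the initial form has no longest term of that
weight. -/
theorem longestMap_initialForm {f : MvPolynomial (Fin d) K} (hf : f ∈ toricIdeal K n) :
    longestMap K n (initialForm f) = 0 := by
  classical
  set k := sInf {k : ℕ | homogeneousComponent k f ≠ 0} with hkdef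
  have hk : ∀ u, coeff u f ≠ 0 → k ≤ u.degree := fun u hu => by
    refine Nat.sInf_le fun h => hu ?_
    simpa [coeff_homogeneousComponent] using congrArg (coeff u) h
  ext s
  rw [coeff_longestMap, Polynomial.coeff_zero]
  have hcoeff : ∀ u, coeff u (initialForm f) = if u.degree = k then coeff u f else 0 := fun u => by
    rw [initialForm, coeff_homogeneousComponent]
  by_cases h : ∃ v, IsLongest n v ∧ Finsupp.weight n v = s ∧ v.degree = k
  · obtain ⟨v, hv, hvs, hvk⟩ := h
    have h0 : (aeval (fun i => (Polynomial.X : Polynomial K) ^ n i) f).coeff s = 0 := by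
      rw [show aeval (fun i => (Polynomial.X : Polynomial K) ^ n i) f = 0 from hf,
        Polynomial.coeff_zero]
    rw [coeff_aeval_pow] at h0
    rw [← h0]
    have hdeg : ∀ u, coeff u f ≠ 0 → Finsupp.weight n u = s → u.degree = k := fun u hu hus =>
      le_antisymm (hvk ▸ hv u (hus.trans hvs.symm)) (hk u hu)
    have hset : {u ∈ (initialForm f).support | IsLongest n u ∧ Finsupp.weight n u = s}
        = {u ∈ f.support | Finsupp.weight n u = s} := by
      ext u
      simp only [Finset.mem_filter, mem_support_iff, hcoeff]
      constructor
      · rintro ⟨h1, -, h2⟩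
        exact ⟨fun h => h1 (by simp [h]), h2⟩
      · rintro ⟨h1, h2⟩
        have := hdeg u h1 h2
        exact ⟨by simpa [this] using h1,
          hv.of_weight_eq (h2.trans hvs.symm) (by rw [this, hvk]), h2⟩
    rw [hset]
    refine Finset.sum_congr rfl fun u hu => ?_
    simp only [Finset.mem_filter, mem_support_iff] at hu
    rw [hcoeff, if_pos (hdeg u hu.1 hu.2)]
  · refine Finset.sum_eq_zero fun u hu => ?_
    simp only [Finset.mem_filter] at hu
    rw [hcoeff, if_neg fun hd => h ⟨u, hu.2.1, hu.2.2, hd⟩]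

theorem mem_initialIdeal_iff {f : MvPolynomial (Fin d) K} :
    f ∈ initialIdeal (toricIdeal K n) ↔ longestMap K n f = 0 := by
  classical
  constructor
  · intro hf
    refine Submodule.span_induction ?_ (map_zero _) ?_ ?_ hf
    · rintro _ ⟨g, hg, rfl⟩
      exact longestMap_initialForm hg
    · intro x y _ _ hx hy
      rw [map_add, hx, hy, add_zero]
    · intro p x _ hx
      exact longestMap_mul_eq_zero p hx
  · intro hf
    -- Choosing one longest monomial per weight factors the quotient map through `longestMap`. The
    -- default `0` serves only weights without a longest monomial.
    let r : ℕ → (Fin d →₀ ℕ) := fun s =>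
      if h : ∃ u, IsLongest n u ∧ Finsupp.weight n u = s then h.choose else 0
    have hr : ∀ u, IsLongest n u → IsLongest n (r (Finsupp.weight n u)) ∧
        Finsupp.weight n (r (Finsupp.weight n u)) = Finsupp.weight n u := fun u hu => by
      have h : ∃ v, IsLongest n v ∧ Finsupp.weight n v = Finsupp.weight n u := ⟨u, hu, rfl⟩
      simp only [r, dif_pos h]
      exact h.choose_spec
    let q := (initialIdeal (toricIdeal K n)).mkQ.restrictScalars K
    let ψ := (Polynomial.basisMonomials K).constr K fun s => q (monomial (r s) 1)
    have hψ : ∀ s, ψ (Polynomial.monomial s 1) = q (monomial (r s) 1) := fun s => by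
      have := Module.Basis.constr_basis (Polynomial.basisMonomials K) K
        (fun s => q (monomial (r s) 1)) s
      rwa [Polynomial.coe_basisMonomials] at this
    have hcomp : ψ ∘ₗ longestMap K n = q := by
      refine linearMap_ext_monomial_one fun u => ?_
      rw [LinearMap.comp_apply]
      by_cases hu : IsLongest n u
      · rw [longestMap_monomial_of_isLongest hu, hψ]
        obtain ⟨h1, h2⟩ := hr u hu
        exact (Submodule.Quotient.eq _).2
          (monomial_sub_monomial_mem_initialIdeal h2 (h1.degree_eq hu h2.symm))
      · rw [longestMap_monomial_of_not_isLongest hu, map_zero]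
        exact ((Submodule.Quotient.mk_eq_zero _).2 (monomial_mem_initialIdeal hu)).symm
    have : q f = 0 := by rw [← hcomp, LinearMap.comp_apply, hf, map_zero]
    exact (Submodule.Quotient.mk_eq_zero _).1 this

end MonomialCurve

/-! ### The Cohen–Macaulay property of the tangent cone in terms of longest monomials. -/

namespace MonomialCurve

open MvPolynomial

/-- A nonzerodivisor lies in no minimal prime, so the height is exactly one and `p` alone is a
regular sequence of the right length. -/
theorem isCohenMacaulayLocalRing_localization_of_height_le_one {R : Type*} [CommRing R]
    [IsNoetherianRing R] (m : Ideal R) [m.IsPrime] (hm : m.height ≤ 1) {p : R} (hpm : p ∈ m)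
    (hp : p ∈ nonZeroDivisors R) : IsCohenMacaulayLocalRing (Localization.AtPrime m) := by
  have hnoeth : IsNoetherianRing (Localization.AtPrime m) :=
    IsLocalization.isNoetherianRing m.primeCompl _ inferInstance
  refine ⟨hnoeth, [algebraMap R _ p], ?_, ?_⟩
  · refine (IsLocalRing.isRegular_iff_isWeaklyRegular_of_subset_maximalIdeal ?_).2 ?_
    · intro r hr
      rw [List.mem_singleton] at hr
      rw [hr]
      exact (IsLocalization.AtPrime.to_map_mem_maximal_iff _ m p).2 hpm
    · rw [RingTheory.Sequence.isWeaklyRegular_singleton_iff]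
      have : algebraMap R (Localization.AtPrime m) p ∈ nonZeroDivisors _ :=
        IsLocalization.map_nonZeroDivisors_le m.primeCompl _ ⟨p, hp, rfl⟩
      exact isSMulRegular_iff_right_eq_zero_of_smul.2 fun x hx =>
        (mul_right_mem_nonZeroDivisors_eq_zero_iff this).1 (by rwa [mul_comm])
  · rw [IsLocalization.AtPrime.ringKrullDim_eq_height m]
    have h0 : m.height ≠ 0 := fun h =>
      Set.disjoint_left.1
        (Ideal.disjoint_nonZeroDivisors_of_mem_minimalPrimes (Ideal.height_eq_zero_iff.1 h)) hpm hp
    have : m.height = 1 := le_antisymm hm (Order.one_le_iff_ne_zero.2 h0)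
    simp [this]

/-- Positive height forces a nonempty regular sequence. Clearing the denominator of its first member
gives an element of `m`; if all of `m` killed `y`, then `y` would vanish in the localization, hence
be killed by some `t ∉ m` as well, and `m` and `t` generate the unit ideal. -/
theorem exists_mul_ne_zero_of_isCohenMacaulayLocalRing {R : Type*} [CommRing R]
    (m : Ideal R) [m.IsMaximal] (hm : m.height ≠ 0)
    (hCM : IsCohenMacaulayLocalRing (Localization.AtPrime m)) {y : R} (hy : y ≠ 0) :
    ∃ a ∈ m, a * y ≠ 0 := by
  by_contra! h
  obtain ⟨-, rs, hrs, hlen⟩ := hCM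
  rw [IsLocalization.AtPrime.ringKrullDim_eq_height m] at hlen
  obtain _ | ⟨r, rs⟩ := rs
  · apply hm
    simpa using hlen.symm
  have hreg := ((RingTheory.Sequence.isRegular_cons_iff _ _ _).1 hrs).1
  have hrm : r ∈ IsLocalRing.maximalIdeal (Localization.AtPrime m) := by
    by_contra hr
    rw [IsLocalRing.mem_maximalIdeal, mem_nonunits_iff, not_not] at hr
    refine hrs.top_ne_smul ?_
    rw [Ideal.ofList_cons, Ideal.span_singleton_eq_top.2 hr, top_sup_eq, Submodule.top_smul]
  obtain ⟨⟨a, s⟩, has⟩ := IsLocalization.surj m.primeCompl r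
  have ham : a ∈ m := by
    rw [← IsLocalization.AtPrime.to_map_mem_maximal_iff (Localization.AtPrime m) m a, ← has]
    exact Ideal.mul_mem_right _ _ hrm
  have hzero : r • algebraMap R (Localization.AtPrime m) y = 0 := by
    have hs := IsLocalization.map_units (Localization.AtPrime m) s
    refine hs.mul_right_eq_zero.1 ?_
    rw [smul_eq_mul, ← mul_assoc, mul_comm _ r, has, ← map_mul, h a ham, map_zero]
  have hy0 := isSMulRegular_iff_right_eq_zero_of_smul.1 hreg _ hzero
  rw [IsLocalization.map_eq_zero_iff m.primeCompl] at hy0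
  obtain ⟨⟨t, ht⟩, hty⟩ := hy0
  obtain ⟨b, c, hc, hbc⟩ := Ideal.IsMaximal.exists_inv (I := m) ‹_› ht
  apply hy
  calc y = (b * t + c) * y := by rw [hbc, one_mul]
    _ = b * (t * y) + c * y := by ring
    _ = 0 := by rw [hty, h c hc, mul_zero, add_zero]

section

variable {K : Type*} [Field K] {d : ℕ} {n : Fin (d + 1) → ℕ}

theorem weight_single_mul (i : Fin (d + 1)) (k : ℕ) :
    Finsupp.weight n (Finsupp.single i k) = k * n i := by
  simp [Finsupp.weight_single]

theorem not_isLongest_single {i : Fin (d + 1)} (hi : n 0 < n i) :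
    ¬ IsLongest n (Finsupp.single i (n 0)) := by
  intro h
  have := h (Finsupp.single 0 (n i)) (by simp only [weight_single_mul, mul_comm])
  simp only [Finsupp.degree_single] at this
  omega

theorem mul_degree_le_weight (hn : ∀ i, n 0 ≤ n i) (u : Fin (d + 1) →₀ ℕ) :
    n 0 * u.degree ≤ Finsupp.weight n u := by
  rw [Finsupp.weight_apply, Finsupp.sum_fintype _ _ (by simp), Finsupp.degree_eq_sum,
    Finset.mul_sum]
  exact Finset.sum_le_sum fun i _ => by
    rw [smul_eq_mul, mul_comm]; exact Nat.mul_le_mul_left _ (hn i)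

theorem mul_degree_lt_weight (hn : ∀ i, i ≠ 0 → n 0 < n i) {u : Fin (d + 1) →₀ ℕ}
    {i : Fin (d + 1)} (hi : i ≠ 0) (hu : u i ≠ 0) :
    n 0 * u.degree < Finsupp.weight n u := by
  have hn' : ∀ i, n 0 ≤ n i := fun i => by
    by_cases h : i = 0
    · rw [h]
    · exact (hn i h).le
  rw [Finsupp.weight_apply, Finsupp.sum_fintype _ _ (by simp), Finsupp.degree_eq_sum,
    Finset.mul_sum]
  refine Finset.sum_lt_sum (fun j _ => ?_) ⟨i, Finset.mem_univ i, ?_⟩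
  · rw [smul_eq_mul, mul_comm]; exact Nat.mul_le_mul_left _ (hn' j)
  · rw [smul_eq_mul, mul_comm]; exact Nat.mul_lt_mul_of_pos_left (hn i hi) (Nat.pos_of_ne_zero hu)

theorem isLongest_single_zero (h0 : 0 < n 0) (hn : ∀ i, n 0 ≤ n i) (k : ℕ) :
    IsLongest n (Finsupp.single 0 k) := by
  intro v hv
  have := mul_degree_le_weight hn v
  rw [hv, weight_single_mul, mul_comm] at this
  rw [Finsupp.degree_single]
  exact Nat.le_of_mul_le_mul_right this h0

theorem IsLongest.eq_single_zero (h0 : 0 < n 0) (hn : ∀ i, i ≠ 0 → n 0 < n i)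
    {u : Fin (d + 1) →₀ ℕ} (hu : IsLongest n u) {k : ℕ} (hw : Finsupp.weight n u = n 0 * k) :
    u = Finsupp.single 0 k := by
  have hk : k ≤ u.degree := by
    have := hu (Finsupp.single 0 k) (by rw [weight_single_mul, hw, mul_comm])
    rwa [Finsupp.degree_single] at this
  have hi : ∀ i, i ≠ 0 → u i = 0 := fun i hi => by
    by_contra h
    have := mul_degree_lt_weight hn hi h
    rw [hw] at this
    exact absurd (Nat.lt_of_mul_lt_mul_left this) (by omega)
  have hu0 : u = Finsupp.single 0 (u 0) := by
    ext i
    by_cases h : i = 0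
    · simp [h]
    · rw [hi i h, Finsupp.single_eq_of_ne h]
  rw [hu0, weight_single_mul, mul_comm] at hw
  rw [hu0, Nat.eq_of_mul_eq_mul_left h0 hw]

/-- Setting all variables but the first equal to zero. -/
noncomputable def axisMap (K : Type*) [Field K] (d : ℕ) :
    MvPolynomial (Fin (d + 1)) K →ₐ[K] Polynomial K :=
  aeval fun i => if i = 0 then Polynomial.X else 0

/-- The only longest monomial of weight `n 0 * k` is the `k`-th power of the first variable. Hence
`axisMap` factors through `longestMap`, by keeping the powers of `t` whose exponent is divisible by
`n 0`. -/
theorem axisMap_eq_zero (h0 : 0 < n 0) (hn : ∀ i, i ≠ 0 → n 0 < n i)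
    {f : MvPolynomial (Fin (d + 1)) K} (hf : f ∈ initialIdeal (toricIdeal K n)) :
    axisMap K d f = 0 := by
  rw [mem_initialIdeal_iff] at hf
  let N : Polynomial K →ₗ[K] Polynomial K := (Polynomial.basisMonomials K).constr K
    fun s => if n 0 ∣ s then Polynomial.X ^ (s / n 0) else 0
  have hN : ∀ s, N (Polynomial.monomial s 1) =
      if n 0 ∣ s then Polynomial.X ^ (s / n 0) else 0 := fun s => by
    have := Module.Basis.constr_basis (Polynomial.basisMonomials K) K
      (fun s => if n 0 ∣ s then (Polynomial.X : Polynomial K) ^ (s / n 0) else 0) s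
    rwa [Polynomial.coe_basisMonomials] at this
  have hsingle : ∀ k, axisMap K d (monomial (Finsupp.single 0 k) 1) = Polynomial.X ^ k :=
    fun k => by simp [axisMap, aeval_monomial]
  have hother : ∀ (u : Fin (d + 1) →₀ ℕ) i, i ≠ 0 → u i ≠ 0 →
      axisMap K d (monomial u 1) = 0 := fun u i hi hu => by
    rw [axisMap, aeval_monomial, Finsupp.prod, map_one, one_mul]
    exact Finset.prod_eq_zero (Finsupp.mem_support_iff.2 hu) (by simp [hi, hu])
  have hcomp : N ∘ₗ longestMap K n = (axisMap K d).toLinearMap := by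
    refine linearMap_ext_monomial_one fun u => ?_
    rw [LinearMap.comp_apply, AlgHom.toLinearMap_apply]
    by_cases hi : ∃ i, i ≠ 0 ∧ u i ≠ 0
    · obtain ⟨i, hi, hui⟩ := hi
      rw [hother u i hi hui]
      by_cases hu : IsLongest n u
      · rw [longestMap_monomial_of_isLongest hu, hN, if_neg]
        rintro ⟨k, hk⟩
        rw [hu.eq_single_zero h0 hn hk, Finsupp.single_eq_of_ne hi] at hui
        exact hui rfl
      · rw [longestMap_monomial_of_not_isLongest hu, map_zero]
    · push Not at hi
      have hu0 : u = Finsupp.single 0 (u 0) := by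
        ext i
        by_cases h : i = 0
        · simp [h]
        · rw [hi i h, Finsupp.single_eq_of_ne h]
      rw [hu0, hsingle, longestMap_monomial_of_isLongest, hN, weight_single_mul,
        if_pos (dvd_mul_left _ _), Nat.mul_div_cancel _ h0]
      refine isLongest_single_zero h0 (fun i => ?_) _
      by_cases h : i = 0
      · rw [h]
      · exact (hn i h).le
  have := LinearMap.congr_fun hcomp f
  rw [LinearMap.comp_apply, hf, map_zero] at this
  exact this.symm

/-- The class of the `i`-th variable in the tangent cone ring. -/
noncomputable abbrev coneVar (K : Type*) [Field K] (n : Fin (d + 1) → ℕ) (i : Fin (d + 1)) :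
    TangentConeRing K n :=
  Ideal.Quotient.mk _ (X i)

theorem isNilpotent_coneVar {i : Fin (d + 1)} (hi : n 0 < n i) :
    IsNilpotent (coneVar K n i) := by
  refine ⟨n 0, ?_⟩
  rw [← map_pow, Ideal.Quotient.eq_zero_iff_mem, X_pow_eq_monomial]
  exact monomial_mem_initialIdeal (not_isLongest_single hi)

/-- Modulo nilpotents only the first variable survives, so the reduced ring is a quotient of `K[t]`.
-/
theorem ringKrullDim_tangentConeRing_le (hn : ∀ i, i ≠ 0 → n 0 < n i) :
    ringKrullDim (TangentConeRing K n) ≤ 1 := by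
  have h1 : ringKrullDim (TangentConeRing K n)
      = ringKrullDim (TangentConeRing K n ⧸ nilradical (TangentConeRing K n)) := by
    rw [ringKrullDim_quotient (nilradical _), PrimeSpectrum.zeroLocus_nilradical, ringKrullDim]
    exact (Order.krullDim_eq_of_orderIso OrderIso.Set.univ).symm
  rw [h1, ← IsPrincipalIdealRing.ringKrullDim_eq_one (Polynomial K)
    (Polynomial.not_isField K)]
  let φ : Polynomial K →ₐ[K] (TangentConeRing K n ⧸ nilradical (TangentConeRing K n)) :=
    Polynomial.aeval (Ideal.Quotient.mk _ (coneVar K n 0))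
  refine ringKrullDim_le_of_surjective φ.toRingHom ?_
  have hcomp : φ.comp (axisMap K d) =
      (Ideal.Quotient.mkₐ K (nilradical (TangentConeRing K n))).comp
        (Ideal.Quotient.mkₐ K (initialIdeal (toricIdeal K n))) := by
    refine MvPolynomial.algHom_ext fun i => ?_
    by_cases hi : i = 0
    · subst hi
      simp [axisMap, φ]
    · have hnil : Ideal.Quotient.mk (nilradical (TangentConeRing K n)) (coneVar K n i) = 0 :=
        Ideal.Quotient.eq_zero_iff_mem.2 (isNilpotent_coneVar (hn i hi))
      simpa [axisMap, hi] using hnil.symm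
  intro y
  obtain ⟨y, rfl⟩ := Ideal.Quotient.mk_surjective y
  obtain ⟨y, rfl⟩ := Ideal.Quotient.mk_surjective y
  exact ⟨axisMap K d y, AlgHom.congr_fun hcomp y⟩

theorem longestMap_X_zero_mul
    (h : ∀ u, IsLongest n u → IsLongest n (u + Finsupp.single 0 1))
    (f : MvPolynomial (Fin (d + 1)) K) :
    longestMap K n (X 0 * f) = Polynomial.X ^ n 0 * longestMap K n f := by
  have : longestMap K n ∘ₗ LinearMap.mulLeft K (X 0) =
      LinearMap.mulLeft K (Polynomial.X ^ n 0) ∘ₗ longestMap K n := by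
    refine linearMap_ext_monomial_one fun u => ?_
    simp only [LinearMap.comp_apply, LinearMap.mulLeft_apply]
    rw [X, monomial_mul, one_mul, add_comm _ u]
    by_cases hu : IsLongest n u
    · rw [longestMap_monomial_of_isLongest hu, longestMap_monomial_of_isLongest (h u hu),
        map_add, weight_single_mul, one_mul, Polynomial.X_pow_eq_monomial,
        Polynomial.monomial_mul_monomial, one_mul, add_comm]
    · rw [longestMap_monomial_of_not_isLongest hu, mul_zero,
        longestMap_monomial_of_not_isLongest fun hh => hu hh.of_add]
  exact LinearMap.congr_fun this f

theorem longestMap_aeval_X_zero_mul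
    (h : ∀ u, IsLongest n u → IsLongest n (u + Finsupp.single 0 1)) (p : Polynomial K)
    (f : MvPolynomial (Fin (d + 1)) K) :
    longestMap K n (Polynomial.aeval (X 0) p * f)
      = Polynomial.expand K (n 0) p * longestMap K n f := by
  induction p using Polynomial.induction_on' with
  | add p q hp hq => simp only [map_add, add_mul, hp, hq]
  | monomial k c =>
    rw [Polynomial.aeval_monomial, Polynomial.expand_monomial, algebraMap_eq, mul_assoc,
      ← smul_eq_C_mul, map_smul, ← Polynomial.C_mul_X_pow_eq_monomial, mul_assoc, ← Polynomial.smul_eq_C_mul]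
    congr 1
    induction k with
    | zero => simp
    | succ k ih =>
      rw [pow_succ', mul_assoc, longestMap_X_zero_mul h, ih]
      ring

/-- Under `longestMap` the first variable acts as `t ^ n 0`, so `p` acts as the nonzero polynomial
`p(t ^ n 0)` on the domain `K[t]`. -/
theorem aeval_coneVar_zero_mem_nonZeroDivisors (h0 : 0 < n 0)
    (h : ∀ u, IsLongest n u → IsLongest n (u + Finsupp.single 0 1)) {p : Polynomial K}
    (hp : p ≠ 0) :
    Polynomial.aeval (coneVar K n 0) p ∈ nonZeroDivisors (TangentConeRing K n) := by
  have hmk : Polynomial.aeval (coneVar K n 0) p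
      = Ideal.Quotient.mk (initialIdeal (toricIdeal K n)) (Polynomial.aeval (X 0) p) :=
    Polynomial.aeval_algHom_apply
      (Ideal.Quotient.mkₐ K (initialIdeal (toricIdeal K n))) (X 0) p
  rw [mem_nonZeroDivisors_iff_left]
  intro y hy
  obtain ⟨y, rfl⟩ := Ideal.Quotient.mk_surjective y
  rw [hmk, ← map_mul, Ideal.Quotient.eq_zero_iff_mem, mem_initialIdeal_iff,
    longestMap_aeval_X_zero_mul h, mul_eq_zero] at hy
  rw [Ideal.Quotient.eq_zero_iff_mem, mem_initialIdeal_iff]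
  exact hy.resolve_left ((Polynomial.expand_eq_zero h0).not.2 hp)

/-- Every maximal ideal, not only the origin, must contain a nonzerodivisor. Residue fields are
finite over `K`, so the minimal polynomial of the residue of the first variable, evaluated at that
variable, supplies one. -/
theorem hasCohenMacaulayTangentCone_of_isLongest_add (h0 : 0 < n 0)
    (hn : ∀ i, i ≠ 0 → n 0 < n i)
    (h : ∀ u, IsLongest n u → IsLongest n (u + Finsupp.single 0 1)) :
    HasCohenMacaulayTangentCone K n := by
  refine ⟨inferInstance, fun m hm => ?_⟩
  let : Field (TangentConeRing K n ⧸ m) := Ideal.Quotient.field m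
  have hfin : Module.Finite K (TangentConeRing K n ⧸ m) :=
    finite_of_finite_type_of_isJacobsonRing K _
  let z : TangentConeRing K n ⧸ m := Ideal.Quotient.mk m (coneVar K n 0)
  have hz : IsIntegral K z := Algebra.IsIntegral.isIntegral z
  refine isCohenMacaulayLocalRing_localization_of_height_le_one m ?_
    (p := Polynomial.aeval (coneVar K n 0) (minpoly K z)) ?_
    (aeval_coneVar_zero_mem_nonZeroDivisors h0 h (minpoly.ne_zero hz))
  · have := (Ideal.height_le_ringKrullDim_of_isPrime (I := m)).trans
      (ringKrullDim_tangentConeRing_le (K := K) hn)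
    exact_mod_cast this
  · rw [← Ideal.Quotient.eq_zero_iff_mem]
    exact (Polynomial.aeval_algHom_apply (Ideal.Quotient.mkₐ K m) (coneVar K n 0)
      (minpoly K z)).symm.trans (minpoly.aeval K z)

/-- If `x ^ u` is longest but its product with the first variable is not, its class is nonzero and
killed by that variable. An associated prime above its annihilator contains all variables, the
others being nilpotent, hence the maximal ideal at the origin. That ideal then annihilates a nonzero
element, although its height is positive. -/
theorem isLongest_add_of_hasCohenMacaulayTangentCone (h0 : 0 < n 0)
    (hn : ∀ i, i ≠ 0 → n 0 < n i) (hCM : HasCohenMacaulayTangentCone K n)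
    (u : Fin (d + 1) →₀ ℕ) (hu : IsLongest n u) : IsLongest n (u + Finsupp.single 0 1) := by
  by_contra hu1
  let ρ : TangentConeRing K n →ₐ[K] Polynomial K :=
    Ideal.Quotient.liftₐ _ (axisMap K d) fun f hf => axisMap_eq_zero h0 hn hf
  have hρ0 : ρ (coneVar K n 0) = Polynomial.X := by
    change axisMap K d (X 0) = _
    simp [axisMap]
  let ε : TangentConeRing K n →ₐ[K] K := (Polynomial.aeval 0).comp ρ
  let m : Ideal (TangentConeRing K n) := RingHom.ker ε
  have hm : m.IsMaximal := RingHom.ker_isMaximal_of_surjective ε.toRingHom fun c =>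
    ⟨algebraMap K _ c, ε.commutes c⟩
  have hPprime : (RingHom.ker ρ).IsPrime := RingHom.ker_isPrime ρ
  have hPm : RingHom.ker ρ ≤ m := fun x hx => by
    change Polynomial.aeval 0 (ρ x) = 0
    rw [RingHom.mem_ker.1 hx, map_zero]
  have hx0m : coneVar K n 0 ∈ m := by
    change Polynomial.aeval 0 (ρ (coneVar K n 0)) = 0
    rw [hρ0, Polynomial.aeval_X]
  have hheight : m.height ≠ 0 := fun h => by
    have hle := (Ideal.height_eq_zero_iff.1 h).2 ⟨hPprime, bot_le⟩ hPm hx0m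
    rw [RingHom.mem_ker, hρ0] at hle
    exact Polynomial.X_ne_zero hle
  let y : TangentConeRing K n := Ideal.Quotient.mk _ (monomial u 1)
  have hy : y ≠ 0 := fun h => by
    rw [Ideal.Quotient.eq_zero_iff_mem, mem_initialIdeal_iff,
      longestMap_monomial_of_isLongest hu] at h
    simp at h
  obtain ⟨P, hP, hyP⟩ := exists_le_isAssociatedPrime_of_isNoetherianRing
    (TangentConeRing K n) y hy
  obtain ⟨hPp, z, hz⟩ := isAssociatedPrime_iff.1 hP
  have hvar : ∀ i, coneVar K n i ∈ P := fun i => by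
    by_cases hi : i = 0
    · subst hi
      refine hyP ?_
      rw [Submodule.mem_colon_singleton, Submodule.mem_bot, smul_eq_mul, ← map_mul,
        Ideal.Quotient.eq_zero_iff_mem, X, monomial_mul, one_mul, add_comm _ u]
      exact monomial_mem_initialIdeal hu1
    · obtain ⟨k, hk⟩ := isNilpotent_coneVar (K := K) (hn i hi)
      exact hPp.mem_of_pow_mem k (hk ▸ P.zero_mem)
  have hmP : m ≤ P := by
    have hvar0 : ∀ i, ε (coneVar K n i) = 0 := fun i => by
      by_cases hi : i = 0
      · rw [hi]
        exact hx0m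
      · exact ((isNilpotent_coneVar (K := K) (hn i hi)).map ε).eq_zero
    have hsub : ∀ f : MvPolynomial (Fin (d + 1)) K,
        Ideal.Quotient.mk (initialIdeal (toricIdeal K n)) f -
          algebraMap K _ (ε (Ideal.Quotient.mk _ f)) ∈ P := by
      intro f
      induction f using MvPolynomial.induction_on with
      | C a =>
        convert P.zero_mem
        rw [sub_eq_zero]
        exact (congrArg (algebraMap K (TangentConeRing K n)) (ε.commutes a)).symm
      | add p q hp hq =>
        convert P.add_mem hp hq using 1
        simp only [map_add]
        ring
      | mul_X p i hp =>
        convert P.mul_mem_left (Ideal.Quotient.mk _ p) (hvar i) using 1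
        rw [map_mul, map_mul, hvar0 i, mul_zero, map_zero, sub_zero]
    intro a ha
    obtain ⟨a, rfl⟩ := Ideal.Quotient.mk_surjective a
    have hεa : ε (Ideal.Quotient.mk _ a) = 0 := ha
    simpa [hεa] using hsub a
  have hz0 : z ≠ 0 := by
    rintro rfl
    exact hPp.ne_top (hz.trans (by simp))
  obtain ⟨a, ham, haz⟩ := exists_mul_ne_zero_of_isCohenMacaulayLocalRing m hheight (hCM.2 m) hz0
  have : a ∈ P := hmP ham
  rw [hz, Submodule.mem_colon_singleton, Submodule.mem_bot, smul_eq_mul] at this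
  exact haz this

theorem hasCohenMacaulayTangentCone_iff (h0 : 0 < n 0) (hn : ∀ i, i ≠ 0 → n 0 < n i) :
    HasCohenMacaulayTangentCone K n ↔
      ∀ u, IsLongest n u → IsLongest n (u + Finsupp.single 0 1) :=
  ⟨isLongest_add_of_hasCohenMacaulayTangentCone h0 hn,
    hasCohenMacaulayTangentCone_of_isLongest_add h0 hn⟩

end

end MonomialCurve

/-! ### Fibres of the curve and the moves given by the five binomials. -/

namespace MonomialCurve

open MvPolynomial

/-- The exponent vector of the monomial `x₁ ^ a * x₂ ^ b * x₃ ^ c * x₄ ^ e`. -/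
noncomputable def expVec (a b c e : ℕ) : Fin 4 →₀ ℕ :=
  Finsupp.equivFunOnFinite.symm ![a, b, c, e]

theorem expVec_self (u : Fin 4 →₀ ℕ) : expVec (u 0) (u 1) (u 2) (u 3) = u := by
  ext i; fin_cases i <;> rfl

theorem expVec_add_single (a b c e : ℕ) :
    expVec a b c e + Finsupp.single 0 1 = expVec (a + 1) b c e := by
  ext i; fin_cases i <;> simp [expVec]

theorem degree_expVec (a b c e : ℕ) : (expVec a b c e).degree = a + b + c + e := by
  simp [Finsupp.degree_eq_sum, Fin.sum_univ_four, expVec]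

theorem weight_expVec (n : Fin 4 → ℕ) (a b c e : ℕ) :
    Finsupp.weight n (expVec a b c e) = a * n 0 + b * n 1 + c * n 2 + e * n 3 := by
  simp [Finsupp.weight_apply, Finsupp.sum_fintype, Fin.sum_univ_four, expVec]

theorem monomial_expVec {K : Type*} [Field K] (a b c e : ℕ) :
    (monomial (expVec a b c e) 1 : MvPolynomial (Fin 4) K)
      = X 0 ^ a * X 1 ^ b * X 2 ^ c * X 3 ^ e := by
  rw [monomial_eq, map_one, one_mul, Finsupp.prod_fintype _ _ (by simp), Fin.prod_univ_four]
  rfl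

open Classical in
/-- If a set of monomials is respected by a family of binomials generating an ideal, then it is
respected by all the binomials of that ideal. -/
theorem mem_iff_mem_of_monomial_sub_mem_span {σ K : Type*} [Field K] {G : Set (MvPolynomial σ K)}
    {S : Set (σ →₀ ℕ)}
    (hG : ∀ g ∈ G, ∃ p q : σ →₀ ℕ, g = monomial p 1 - monomial q 1 ∧
      ∀ w, w + p ∈ S ↔ w + q ∈ S)
    {u v : σ →₀ ℕ} (h : (monomial u 1 - monomial v 1 : MvPolynomial σ K) ∈ Ideal.span G) :
    u ∈ S ↔ v ∈ S := by
  -- The sum of the coefficients over `S`; it kills every multiple of a generator because the two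
  -- terms enter or miss `S` together.
  let L : MvPolynomial σ K →ₗ[K] K :=
    (basisMonomials σ K).constr K fun u => if u ∈ S then 1 else 0
  have hL : ∀ u, L (monomial u 1) = if u ∈ S then 1 else 0 := fun u => by
    have := Module.Basis.constr_basis (basisMonomials σ K) K
      (fun u => if u ∈ S then (1 : K) else 0) u
    rwa [coe_basisMonomials] at this
  have hzero : ∀ f ∈ Ideal.span G, ∀ p : MvPolynomial σ K, L (p * f) = 0 := by
    intro f hf
    induction hf using Submodule.span_induction with
    | mem g hg =>
      intro p
      obtain ⟨s, t, rfl, hst⟩ := hG g hg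
      induction p using MvPolynomial.induction_on' with
      | monomial w c =>
        have hc : monomial w c = c • (monomial w 1 : MvPolynomial σ K) := by
          simp [smul_monomial]
        rw [hc, smul_mul_assoc, map_smul, mul_sub, monomial_mul, monomial_mul, map_sub, one_mul,
          hL, hL]
        simp [hst w]
      | add p q hp hq => rw [add_mul, map_add, hp, hq, add_zero]
    | zero => simp
    | add x y _ _ hx hy =>
      intro p
      rw [mul_add, map_add, hx, hy, add_zero]
    | smul q x _ hx =>
      intro p
      rw [smul_eq_mul, ← mul_assoc, hx]
  have := hzero _ h 1
  rw [one_mul, map_sub, hL, hL] at this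
  by_cases hu : u ∈ S <;> by_cases hv : v ∈ S <;> simp_all

theorem exists_isLongest_weight_eq {d : ℕ} {n : Fin d → ℕ} (hn : ∀ i, 0 < n i)
    (w : Fin d →₀ ℕ) :
    ∃ v, IsLongest n v ∧ Finsupp.weight n v = Finsupp.weight n w := by
  by_contra! h
  have hk : ∀ k, ∃ v : Fin d →₀ ℕ, Finsupp.weight n v = Finsupp.weight n w ∧ k ≤ v.degree := by
    intro k
    induction k with
    | zero => exact ⟨w, rfl, Nat.zero_le _⟩
    | succ k ih =>
      obtain ⟨v, hv, hvk⟩ := ih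
      obtain ⟨v', hv', hlt⟩ := exists_degree_lt_of_not_isLongest fun hl => h v hl hv
      exact ⟨v', hv'.trans hv, hvk.trans_lt hlt⟩
  obtain ⟨v, hv, hlt⟩ := hk (Finsupp.weight n w + 1)
  have : v.degree ≤ Finsupp.weight n v := by
    rw [Finsupp.weight_apply, Finsupp.sum_fintype _ _ (by simp), Finsupp.degree_eq_sum]
    exact Finset.sum_le_sum fun i _ => Nat.le_mul_of_pos_right _ (hn i)
  omega

namespace IsCase3b

variable {K : Type*} [Field K] {n : Fin 4 → ℕ} {a1 a2 a3 a4 a12 a14 a23 a24 a31 a32 a41 a43 : ℕ}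

/-- The binomials generate `I(C)`, so the moves connect each fibre and an invariant property is
constant on it. -/
theorem iff_of_weight_eq (hc : IsCase3b K n a1 a2 a3 a4 a12 a14 a23 a24 a31 a32 a41 a43)
    (P : ℕ → ℕ → ℕ → ℕ → Prop)
    (h1 : ∀ a b c e, P (a + a1) b c e ↔ P a (b + a12) c (e + a14))
    (h2 : ∀ a b c e, P a (b + a2) c e ↔ P a b (c + a23) (e + a24))
    (h3 : ∀ a b c e, P a b (c + a3) e ↔ P (a + a31) (b + a32) c e)
    (h4 : ∀ a b c e, P a b c (e + a4) ↔ P (a + a41) b (c + a43) e)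
    (h5 : ∀ a b c e, P a (b + a12) (c + a43) e ↔ P (a + a31) b c (e + a24))
    {a b c e a' b' c' e' : ℕ}
    (hw : a * n 0 + b * n 1 + c * n 2 + e * n 3 = a' * n 0 + b' * n 1 + c' * n 2 + e' * n 3) :
    P a b c e ↔ P a' b' c' e' := by
  have hmem : (monomial (expVec a b c e) 1 - monomial (expVec a' b' c' e') 1 :
      MvPolynomial (Fin 4) K) ∈ Ideal.span
        (case3bGenerators K a1 a2 a3 a4 a12 a14 a23 a24 a31 a32 a41 a43) := by
    rw [hc.span_eq, monomial_sub_monomial_mem_toricIdeal_iff, weight_expVec, weight_expVec, hw]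
  refine mem_iff_mem_of_monomial_sub_mem_span (S := {u | P (u 0) (u 1) (u 2) (u 3)}) ?_ hmem
  rintro g (rfl | rfl | rfl | rfl | rfl)
  · exact ⟨expVec a1 0 0 0, expVec 0 a12 0 a14, by simp [monomial_expVec],
      fun w => h1 (w 0) (w 1) (w 2) (w 3)⟩
  · exact ⟨expVec 0 a2 0 0, expVec 0 0 a23 a24, by simp [monomial_expVec],
      fun w => h2 (w 0) (w 1) (w 2) (w 3)⟩
  · exact ⟨expVec 0 0 a3 0, expVec a31 a32 0 0, by simp [monomial_expVec],
      fun w => h3 (w 0) (w 1) (w 2) (w 3)⟩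
  · exact ⟨expVec 0 0 0 a4, expVec a41 0 a43 0, by simp [monomial_expVec],
      fun w => h4 (w 0) (w 1) (w 2) (w 3)⟩
  · exact ⟨expVec 0 a12 a43 0, expVec a31 0 0 a24, by simp [monomial_expVec],
      fun w => h5 (w 0) (w 1) (w 2) (w 3)⟩

/-- A monomial divisible by no term of the five binomials is the only one of its weight. -/
theorem eq_of_weight_eq (hc : IsCase3b K n a1 a2 a3 a4 a12 a14 a23 a24 a31 a32 a41 a43)
    {a b c e a' b' c' e' : ℕ}
    (h1 : a < a1) (h1' : a12 ≤ b → ¬ a14 ≤ e) (h2 : b < a2) (h2' : a23 ≤ c → ¬ a24 ≤ e)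
    (h3 : c < a3) (h3' : a31 ≤ a → ¬ a32 ≤ b) (h4 : e < a4) (h4' : a41 ≤ a → ¬ a43 ≤ c)
    (h5 : a12 ≤ b → ¬ a43 ≤ c) (h5' : a31 ≤ a → ¬ a24 ≤ e)
    (hw : a * n 0 + b * n 1 + c * n 2 + e * n 3 = a' * n 0 + b' * n 1 + c' * n 2 + e' * n 3) :
    a' = a ∧ b' = b ∧ c' = c ∧ e' = e := by
  refine (hc.iff_of_weight_eq (fun x y z t => x = a ∧ y = b ∧ z = c ∧ t = e)
    ?_ ?_ ?_ ?_ ?_ hw).1 ⟨rfl, rfl, rfl, rfl⟩ <;>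
  · intro x y z t
    omega

/-- The fibre of `x₂ ^ (b + a₂) * x₃ ^ c * x₄ ^ e`, for small `b`, `c` and `e`, consists of this
monomial and `x₂ ^ b * x₃ ^ (c + a₂₃) * x₄ ^ (e + a₂₄)`. -/
theorem first_eq_zero_of_weight_eq (hc : IsCase3b K n a1 a2 a3 a4 a12 a14 a23 a24 a31 a32 a41 a43)
    (hle : a43 ≤ a23) (hs3 : a3 = a23 + a43) (hs4 : a4 = a14 + a24)
    {b c e a' b' c' e' : ℕ} (hb : b < a12) (hcc : c < a43) (he : e < a14)
    (hw : (b + a2) * n 1 + c * n 2 + e * n 3 = a' * n 0 + b' * n 1 + c' * n 2 + e' * n 3) :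
    a' = 0 := by
  obtain ⟨-, h12⟩ := hc.bound12
  have h14 := hc.bound14.1
  have h23 := hc.bound23.1
  have h24 := hc.bound24.1
  have h31 := hc.bound31
  have h41 := hc.bound41.1
  have := (hc.iff_of_weight_eq (fun x y z t => x = 0 ∧
    ((y = b + a2 ∧ z = c ∧ t = e) ∨ (y = b ∧ z = c + a23 ∧ t = e + a24)))
    (a := 0) (a' := a') ?_ ?_ ?_ ?_ ?_ (by rw [zero_mul, zero_add]; exact hw)).1
    ⟨rfl, Or.inl ⟨rfl, rfl, rfl⟩⟩
  · exact this.1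
  all_goals
    intro x y z t
    omega

theorem weight_relations (hc : IsCase3b K n a1 a2 a3 a4 a12 a14 a23 a24 a31 a32 a41 a43) :
    a1 * n 0 = a12 * n 1 + a14 * n 3 ∧ a2 * n 1 = a23 * n 2 + a24 * n 3 ∧
    a3 * n 2 = a31 * n 0 + a32 * n 1 ∧ a4 * n 3 = a41 * n 0 + a43 * n 2 ∧
    a12 * n 1 + a43 * n 2 = a31 * n 0 + a24 * n 3 := by
  have key : ∀ a b c e a' b' c' e' : ℕ,
      (monomial (expVec a b c e) 1 - monomial (expVec a' b' c' e') 1 : MvPolynomial (Fin 4) K) ∈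
        case3bGenerators K a1 a2 a3 a4 a12 a14 a23 a24 a31 a32 a41 a43 →
      a * n 0 + b * n 1 + c * n 2 + e * n 3 = a' * n 0 + b' * n 1 + c' * n 2 + e' * n 3 := by
    intro a b c e a' b' c' e' h
    have := Ideal.subset_span h
    rw [SetLike.mem_coe, hc.span_eq, monomial_sub_monomial_mem_toricIdeal_iff, weight_expVec,
      weight_expVec] at this
    exact this
  refine ⟨?_, ?_, ?_, ?_, ?_⟩
  · simpa using key a1 0 0 0 0 a12 0 a14 (by simp [monomial_expVec, case3bGenerators])
  · simpa using key 0 a2 0 0 0 0 a23 a24 (by simp [monomial_expVec, case3bGenerators])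
  · simpa using key 0 0 a3 0 a31 a32 0 0 (by simp [monomial_expVec, case3bGenerators])
  · simpa using key 0 0 0 a4 a41 0 a43 0 (by simp [monomial_expVec, case3bGenerators])
  · simpa using key 0 a12 a43 0 a31 0 0 a24 (by simp [monomial_expVec, case3bGenerators])

theorem lt_chain (hc : IsCase3b K n a1 a2 a3 a4 a12 a14 a23 a24 a31 a32 a41 a43) :
    0 < n 0 ∧ n 0 < n 1 ∧ n 1 < n 2 ∧ n 2 < n 3 :=
  ⟨hc.pos, hc.strictMono (by decide), hc.strictMono (by decide), hc.strictMono (by decide)⟩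

/-- The first and fifth relations give `(a₁₄ + a₂₄) n₄ = (a₁ - a₃₁) n₁ + a₄₃ n₃`. If the sum
exceeded or fell short of `a₄`, then `x₁ ^ (a₁ - a₃₁)` or `x₄ ^ (a₁₄ + a₂₄)`, each alone in its
fibre, would share it with another monomial. -/
theorem exponent_sum_fourth (hc : IsCase3b K n a1 a2 a3 a4 a12 a14 a23 a24 a31 a32 a41 a43) :
    a4 = a14 + a24 := by
  obtain ⟨w1, -, -, w4, w5⟩ := hc.weight_relations
  have h12 := hc.bound12
  have h14 := hc.bound14
  have h23 := hc.bound23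
  have h24 := hc.bound24
  have h31 := hc.bound31
  have h32 := hc.bound32
  have h41 := hc.bound41
  have h43 := hc.bound43
  obtain ⟨k, hk⟩ := Nat.exists_eq_add_of_le h31.2.le
  rcases le_or_gt a4 (a14 + a24) with h | h
  · obtain ⟨l, hl⟩ := Nat.exists_eq_add_of_le h
    have := hc.eq_of_weight_eq (a := k) (b := 0) (c := 0) (e := 0) (a' := a41) (b' := 0)
      (c' := 0) (e' := l) (by omega) (by omega) (by omega) (by omega) (by omega) (by omega)
      (by omega) (by omega) (by omega) (by omega) (by
        have : (a14 + a24) * n 3 = (a4 + l) * n 3 := by rw [hl]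
        rw [hk] at w1
        linarith)
    omega
  · have := hc.eq_of_weight_eq (a := 0) (b := 0) (c := 0) (e := a14 + a24) (a' := k) (b' := 0)
      (c' := a43) (e' := 0) (by omega) (by omega) (by omega) (by omega) (by omega) (by omega)
      (by omega) (by omega) (by omega) (by omega) (by
        rw [hk] at w1
        linarith)
    omega

/-- Eliminating `n₁` and `n₄` gives `(a₂ - a₁₂) n₂ + (a₃ - a₄₃) n₃ = a₃₂ n₂ + a₂₃ n₃`. A discrepancy
`l` between the two coefficients of `n₃` would give `x₃ ^ l`, alone in its fibre, the weight of a
power of `x₂`. -/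
theorem exponent_sum_third (hc : IsCase3b K n a1 a2 a3 a4 a12 a14 a23 a24 a31 a32 a41 a43) :
    a3 = a23 + a43 := by
  obtain ⟨-, w2, w3, -, w5⟩ := hc.weight_relations
  obtain ⟨hn0, hn1, hn2, hn3⟩ := hc.lt_chain
  have h12 := hc.bound12
  have h14 := hc.bound14
  have h23 := hc.bound23
  have h24 := hc.bound24
  have h31 := hc.bound31
  have h32 := hc.bound32
  have h41 := hc.bound41
  have h43 := hc.bound43
  obtain ⟨p, hp⟩ := Nat.exists_eq_add_of_le h12.2.le
  obtain ⟨q, hq⟩ := Nat.exists_eq_add_of_le h43.2.le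
  have hpq : p * n 1 + q * n 2 = a32 * n 1 + a23 * n 2 := by
    rw [hp] at w2
    rw [hq] at w3
    linarith
  rcases le_or_gt q a23 with h | h
  · obtain ⟨l, hl⟩ := Nat.exists_eq_add_of_le h
    have hpl : p * n 1 = a32 * n 1 + l * n 2 := by
      rw [hl] at hpq
      linarith
    have hle : a32 ≤ p := Nat.le_of_mul_le_mul_right (by omega) (hn0.trans hn1)
    obtain ⟨m, hm⟩ := Nat.exists_eq_add_of_le hle
    have := hc.eq_of_weight_eq (a := 0) (b := 0) (c := l) (e := 0) (a' := 0) (b' := m)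
      (c' := 0) (e' := 0) (by omega) (by omega) (by omega) (by omega) (by omega) (by omega)
      (by omega) (by omega) (by omega) (by omega) (by
        rw [hm] at hpl
        linarith)
    omega
  · obtain ⟨l, hl⟩ := Nat.exists_eq_add_of_le h.le
    have hpl : p * n 1 + l * n 2 = a32 * n 1 := by
      rw [hl] at hpq
      linarith
    have hle : p ≤ a32 := Nat.le_of_mul_le_mul_right (by omega) (hn0.trans hn1)
    obtain ⟨m, hm⟩ := Nat.exists_eq_add_of_le hle
    have := hc.eq_of_weight_eq (a := 0) (b := 0) (c := l) (e := 0) (a' := 0) (b' := m)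
      (c' := 0) (e' := 0) (by omega) (by omega) (by omega) (by omega) (by omega) (by omega)
      (by omega) (by omega) (by omega) (by omega) (by
        rw [hm] at hpl
        linarith)
    omega

/-- At equal weight, the side built from lighter variables is longer. -/
theorem degree_relations (hc : IsCase3b K n a1 a2 a3 a4 a12 a14 a23 a24 a31 a32 a41 a43) :
    a12 + a14 < a1 ∧ a23 + a24 < a2 ∧ a3 < a31 + a32 ∧ a4 < a41 + a43 := by
  obtain ⟨w1, w2, w3, w4, -⟩ := hc.weight_relations
  obtain ⟨hn0, hn1, hn2, hn3⟩ := hc.lt_chain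
  have h12 := hc.bound12.1
  have h24 := hc.bound24.1
  have h31 := hc.bound31.1
  have h41 := hc.bound41.1
  refine ⟨?_, ?_, ?_, ?_⟩
  · refine Nat.lt_of_mul_lt_mul_right (a := n 0) ?_
    have := Nat.mul_lt_mul_of_pos_left hn1 h12
    have := Nat.mul_le_mul_left a14 (hn1.trans (hn2.trans hn3)).le
    linarith
  · refine Nat.lt_of_mul_lt_mul_right (a := n 1) ?_
    have := Nat.mul_lt_mul_of_pos_left (hn2.trans hn3) h24
    have := Nat.mul_le_mul_left a23 hn2.le
    linarith
  · refine Nat.lt_of_mul_lt_mul_right (a := n 2) ?_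
    have := Nat.mul_lt_mul_of_pos_left (hn1.trans hn2) h31
    have := Nat.mul_le_mul_left a32 hn2.le
    linarith
  · refine Nat.lt_of_mul_lt_mul_right (a := n 3) ?_
    have := Nat.mul_lt_mul_of_pos_left (hn1.trans (hn2.trans hn3)) h41
    have := Nat.mul_le_mul_left a43 hn3.le
    linarith

/-! ### Necessity and sufficiency of the numerical conditions. -/

/-- If multiplication by `x₁` preserves longest monomials, a monomial `x₃ ^ c * x₄ ^ e` divisible
by no term of the five binomials remains longest after multiplication by `x₁ ^ k`. -/
theorem sum_le_of_isLongest_add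
    (hc : IsCase3b K n a1 a2 a3 a4 a12 a14 a23 a24 a31 a32 a41 a43)
    (h : ∀ u, IsLongest n u → IsLongest n (u + Finsupp.single 0 1))
    {k c e b' c' : ℕ} (h2' : a23 ≤ c → ¬ a24 ≤ e) (h3 : c < a3) (h4 : e < a4)
    (hw : k * n 0 + c * n 2 + e * n 3 = b' * n 1 + c' * n 2) :
    b' + c' ≤ k + c + e := by
  have h12 := hc.bound12
  have h31 := hc.bound31
  have h41 := hc.bound41
  have hk : IsLongest n (expVec k 0 c e) := by
    clear hw
    induction k with
    | zero =>
      intro v hv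
      rw [← expVec_self v, weight_expVec, weight_expVec] at hv
      have := hc.eq_of_weight_eq (by omega) (by omega) (by omega) h2' h3 (by omega) h4 (by omega)
        (by omega) (by omega) hv.symm
      rw [← expVec_self v, degree_expVec, degree_expVec]
      omega
    | succ k ih =>
      rw [← expVec_add_single]
      exact h _ ih
  have := hk (expVec 0 b' c' 0) (by
    rw [weight_expVec, weight_expVec]
    linarith)
  rw [degree_expVec, degree_expVec] at this
  omega

theorem conditions_of_isLongest_add
    (hc : IsCase3b K n a1 a2 a3 a4 a12 a14 a23 a24 a31 a32 a41 a43) (hle : a43 ≤ a23)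
    (h : ∀ u, IsLongest n u → IsLongest n (u + Finsupp.single 0 1)) :
    a12 + a43 ≤ a31 + a24 ∧
      ((a24 < a14 ∧ a2 + a12 + a43 ≤ a31 + 2 * a24 + a23) ∨
        (a14 ≤ a24 ∧ a2 + a12 + a14 ≤ a1 + a23 + a24)) := by
  obtain ⟨w1, w2, w3, w4, w5⟩ := hc.weight_relations
  have hs3 := hc.exponent_sum_third
  have hs4 := hc.exponent_sum_fourth
  have h14 := hc.bound14
  have h23 := hc.bound23
  have h24 := hc.bound24
  have h43 := hc.bound43
  refine ⟨?_, ?_⟩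
  · have := hc.sum_le_of_isLongest_add h (k := a31) (c := 0) (e := a24) (b' := a12) (c' := a43)
      (by omega) (by omega) (by omega) (by linarith)
    omega
  · rcases lt_or_ge a24 a14 with hlt | hge
    · obtain ⟨l, hl⟩ := Nat.exists_eq_add_of_le hle
      -- From `x₂ ^ (a₂ + a₁₂)`, apply the second binomial and then the fifth. Since `a₄ = a₁₄ +
      -- a₂₄`, the bound `2 a₂₄ < a₄` is exactly `a₂₄ < a₁₄`.
      have := hc.sum_le_of_isLongest_add h (k := a31) (c := l) (e := 2 * a24) (b' := a2 + a12)
        (c' := 0) (by omega) (by omega) (by omega) (by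
          rw [hl] at w2
          linarith)
      omega
    · obtain ⟨l, hl⟩ := Nat.exists_eq_add_of_le hge
      -- Here the second binomial is followed by the first, which needs `a₁₄ ≤ a₂₄`.
      have := hc.sum_le_of_isLongest_add h (k := a1) (c := a23) (e := l) (b' := a2 + a12)
        (c' := 0) (by omega) (by omega) (by omega) (by
          rw [hl] at w2
          linarith)
      omega

/-- Under the numerical conditions, a fibre containing a multiple of `x₁` contains one of the
largest degree. -/
theorem exists_first_pos_of_conditions
    (hc : IsCase3b K n a1 a2 a3 a4 a12 a14 a23 a24 a31 a32 a41 a43) (hle : a43 ≤ a23)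
    (h1 : a12 + a43 ≤ a31 + a24)
    (h2 : (a24 < a14 ∧ a2 + a12 + a43 ≤ a31 + 2 * a24 + a23) ∨
        (a14 ≤ a24 ∧ a2 + a12 + a14 ≤ a1 + a23 + a24))
    {b c e a' b' c' e' : ℕ} (hlong : IsLongest n (expVec 0 b c e)) (ha' : 0 < a')
    (hw : b * n 1 + c * n 2 + e * n 3 = a' * n 0 + b' * n 1 + c' * n 2 + e' * n 3) :
    ∃ x y z t : ℕ, 0 < x ∧ b + c + e ≤ x + y + z + t ∧
      x * n 0 + y * n 1 + z * n 2 + t * n 3 = b * n 1 + c * n 2 + e * n 3 := by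
  obtain ⟨w1, w2, w3, w4, w5⟩ := hc.weight_relations
  obtain ⟨d1, d2, d3, d4⟩ := hc.degree_relations
  have hs3 := hc.exponent_sum_third
  have hs4 := hc.exponent_sum_fourth
  have h12 := hc.bound12
  have h14 := hc.bound14
  have h23 := hc.bound23
  have h24 := hc.bound24
  have h31 := hc.bound31
  have h32 := hc.bound32
  have h41 := hc.bound41
  have h43 := hc.bound43
  by_cases m1 : a12 ≤ b ∧ a14 ≤ e
  · obtain ⟨⟨p, rfl⟩, ⟨q, rfl⟩⟩ :=
      m1.imp Nat.exists_eq_add_of_le Nat.exists_eq_add_of_le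
    exact ⟨a1, p, c, q, by omega, by omega, by linarith⟩
  by_cases m3 : a3 ≤ c
  · obtain ⟨p, rfl⟩ := Nat.exists_eq_add_of_le m3
    exact ⟨a31, b + a32, p, e, by omega, by omega, by linarith⟩
  by_cases m4 : a4 ≤ e
  · obtain ⟨p, rfl⟩ := Nat.exists_eq_add_of_le m4
    exact ⟨a41, b, c + a43, p, by omega, by omega, by linarith⟩
  by_cases m5 : a12 ≤ b ∧ a43 ≤ c
  · obtain ⟨⟨p, rfl⟩, ⟨q, rfl⟩⟩ :=
      m5.imp Nat.exists_eq_add_of_le Nat.exists_eq_add_of_le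
    exact ⟨a31, p, q, e + a24, by omega, by omega, by linarith⟩
  -- This move creates no `x₁`, but it lengthens the monomial, which is impossible for a longest
  -- one.
  by_cases m2 : a23 ≤ c ∧ a24 ≤ e
  · obtain ⟨⟨p, rfl⟩, ⟨q, rfl⟩⟩ :=
      m2.imp Nat.exists_eq_add_of_le Nat.exists_eq_add_of_le
    have := hlong (expVec 0 (b + a2) p q) (by
      rw [weight_expVec, weight_expVec]
      linarith)
    rw [degree_expVec, degree_expVec] at this
    omega
  by_cases m6 : a2 + a12 ≤ b
  · obtain ⟨p, rfl⟩ := Nat.exists_eq_add_of_le m6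
    rcases h2 with ⟨-, h2⟩ | ⟨hge, h2⟩
    · obtain ⟨l, hl⟩ := Nat.exists_eq_add_of_le hle
      refine ⟨a31, p, c + l, e + 2 * a24, by omega, by omega, ?_⟩
      rw [hl] at w2
      linarith
    · obtain ⟨l, hl⟩ := Nat.exists_eq_add_of_le hge
      refine ⟨a1, p, c + a23, e + l, by omega, by omega, ?_⟩
      rw [hl] at w2
      linarith
  -- With no lengthening move and no double move left, the fibre is a singleton or the two-element
  -- fibre of `first_eq_zero_of_weight_eq`; neither contains a multiple of `x₁`.
  exfalso
  by_cases m7 : a2 ≤ b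
  · obtain ⟨p, rfl⟩ := Nat.exists_eq_add_of_le m7
    have := hc.first_eq_zero_of_weight_eq hle hs3 hs4 (b := p) (c := c) (e := e) (by omega)
      (by omega) (by omega) (by rw [add_comm p]; exact hw)
    omega
  · have := hc.eq_of_weight_eq (a := 0) (b := b) (c := c) (e := e) (a' := a') (b' := b')
      (c' := c') (e' := e') (by omega) (by omega) (by omega) (by omega)
      (by omega) (by omega) (by omega) (by omega) (by omega) (by omega)
      (by rw [zero_mul, zero_add]; exact hw)
    omega

/-- Some longest monomial in the fibre of `x₁ x ^ u` is divisible by `x₁`; cancelling `x₁` lands in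
the fibre of `u`, where the degree is at most that of `u`. -/
theorem isLongest_add_of_conditions
    (hc : IsCase3b K n a1 a2 a3 a4 a12 a14 a23 a24 a31 a32 a41 a43) (hle : a43 ≤ a23)
    (h1 : a12 + a43 ≤ a31 + a24)
    (h2 : (a24 < a14 ∧ a2 + a12 + a43 ≤ a31 + 2 * a24 + a23) ∨
        (a14 ≤ a24 ∧ a2 + a12 + a14 ≤ a1 + a23 + a24))
    (u : Fin 4 →₀ ℕ) (hu : IsLongest n u) : IsLongest n (u + Finsupp.single 0 1) := by
  obtain ⟨hn0, hn1, hn2, hn3⟩ := hc.lt_chain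
  obtain ⟨v, hv, hvw⟩ := exists_isLongest_weight_eq (n := n)
    (fun i => hc.pos.trans_le (hc.strictMono.monotone (Fin.zero_le i))) (u + Finsupp.single 0 1)
  refine hv.of_weight_eq hvw.symm ?_
  rw [← expVec_self u, ← expVec_self v, expVec_add_single, weight_expVec, weight_expVec] at hvw
  rw [← expVec_self u, ← expVec_self v, expVec_add_single, degree_expVec, degree_expVec]
  have key : ∃ x y z t : ℕ, 0 < x ∧ v 0 + v 1 + v 2 + v 3 ≤ x + y + z + t ∧
      x * n 0 + y * n 1 + z * n 2 + t * n 3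
        = v 0 * n 0 + v 1 * n 1 + v 2 * n 2 + v 3 * n 3 := by
    rcases Nat.eq_zero_or_pos (v 0) with h0 | h0
    · rw [← expVec_self v, h0] at hv
      rw [h0, zero_mul, zero_add] at hvw
      rw [h0]
      simpa using hc.exists_first_pos_of_conditions hle h1 h2 hv (Nat.succ_pos _) hvw
    · exact ⟨v 0, v 1, v 2, v 3, h0, le_rfl, rfl⟩
  obtain ⟨x, y, z, t, hx, hd, hw⟩ := key
  obtain ⟨x, rfl⟩ : ∃ x', x = x' + 1 := ⟨x - 1, by omega⟩
  have := hu (expVec x y z t) (by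
    rw [← expVec_self u, weight_expVec, weight_expVec]
    linarith)
  rw [← expVec_self u, degree_expVec, degree_expVec] at this
  omega

end IsCase3b

end MonomialCurve

theorem mainTheorem8 (K : Type*) [Field K] (n : Fin 4 → ℕ)
    (a1 a2 a3 a4 a12 a14 a23 a24 a31 a32 a41 a43 : ℕ)
    (hcase : MonomialCurve.IsCase3b K n a1 a2 a3 a4 a12 a14 a23 a24 a31 a32 a41 a43)
    (h : a43 ≤ a23) :
    MonomialCurve.HasCohenMacaulayTangentCone K n ↔
      a12 + a43 ≤ a31 + a24 ∧
      ((a24 < a14 ∧ (a2 : ℤ) + a12 ≤ a31 + 2 * a24 + a23 - a43) ∨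
        (a14 ≤ a24 ∧ (a2 : ℤ) + a12 ≤ a1 + a23 + a24 - a14)) := by
  rw [MonomialCurve.hasCohenMacaulayTangentCone_iff hcase.pos
    fun i hi => hcase.strictMono (Fin.pos_iff_ne_zero.2 hi)]
  constructor
  · intro hlong
    have := hcase.conditions_of_isLongest_add h hlong
    omega
  · rintro ⟨h1, h2⟩
    exact hcase.isLongest_add_of_conditions h h1 (by omega)
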